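/- All graphs are finite, simple and undirected. A $k$-matching of a graph $G$ is a set of $k$ pairwise nonincident edges, $m(G,k)$ is the number of $k$-matchings of $G$ (with $m(G,0)=1$), and the matching polynomial of a graph $G$ with $n$ vertices is $\mu(G,x)=\sum_{k\ge 0}(-1)^k m(G,k)x^{n-2k}$. Two nonisomorphic graphs with the same matching polynomial are called comatching, and a graph is matching unique if no graph is comatching with it. For integers $t\ge 0$ and $1\le \ell\le k$, let $K(k,t;\ell)$ be the graph obtained from the disjoint union $K_{1,k}\cup tK_1$ of a star and $t$ isolated vertices by adding a new vertex and joining it to all the $t$ isolated vertices and to exactly $\ell$ leaves of the star, but not to its center (for $k=1$, either vertex of $K_{1,1}$ is taken as the center). For $1\le\ell\le3$ let $L(t,\ell)$ be the graph obtained from $K_3\cup tK_1$ by adding a new vertex and joining it to all the $t$ isolated vertices and to exactly $\ell$ vertices of the triangle. **Theorem.** Let $t\ge0$ and $1\le\ell\le k$ be integers with $|\ell+t-k|\le 1$. Then $K(k,t;\ell)$ is matching unique if and only if $$(k,t,\ell)\notin\{(2,1,1),(2,1,2),(2,2,1),(3,0,2),(3,1,1),(3,1,2),(3,2,2),(3,0,3),(4,1,2),(4,3,1)\}.$$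 Moreover, in the exceptional cases, comatching graphs are as follows: $K(2,1;1)$ is comatching with $K_{1,1}\cup K_3$; $K(2,1;2)$ and $K(3,0;2)$ with $L(1,1)$; $K(2,2;1)$ and $K(3,1;1)$ with $C_5\cup K_1$; $K(3,1;2)$ with $L(2,1)$; $K(3,2;2)$ and $K(4,1;2)$ with $L(3,1)$; $K(3,0;3)$ with the house (the $5$-cycle with one chord); and $K(4,3;1)$ with $K_{1,5}\cup K_3$. -/

import Mathlib

open Polynomial
open scoped SimpleGraph

/-- `M` is a set of `k` pairwise nonincident edges of `G`. -/
def SimpleGraph.IsKMatching {V : Type*} (G : SimpleGraph V) (k : ℕ) (M : Finset (Sym2 V)) : Prop :=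
  (∀ e ∈ M, e ∈ G.edgeSet) ∧ M.card = k ∧
    ∀ e ∈ M, ∀ f ∈ M, e ≠ f → ∀ v : V, ¬ (v ∈ e ∧ v ∈ f)

/-- The number `m(G, k)` of `k`-matchings of `G`. -/
noncomputable def SimpleGraph.matchingNumber {V : Type*} (G : SimpleGraph V) (k : ℕ) : ℕ :=
  {M : Finset (Sym2 V) | G.IsKMatching k M}.ncard

/-- The matching polynomial `μ(G, x) = ∑_k (-1)^k m(G, k) x^(n - 2k)` of a graph with `n` vertices.
A graph with `n` vertices has no `k`-matching with `2k > n`, so the sum stops at `k = ⌊n/2⌋`. -/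
noncomputable def SimpleGraph.matchingPoly {V : Type*} [Finite V] (G : SimpleGraph V) : ℤ[X] :=
  ∑ k ∈ Finset.range (Nat.card V / 2 + 1),
    C ((-1) ^ k * (G.matchingNumber k : ℤ)) * X ^ (Nat.card V - 2 * k)

/-- Two nonisomorphic graphs with the same matching polynomial are comatching. -/
def SimpleGraph.Comatching {V W : Type*} [Finite V] [Finite W]
    (G : SimpleGraph V) (H : SimpleGraph W) : Prop :=
  IsEmpty (G ≃g H) ∧ G.matchingPoly = H.matchingPoly

/-- A finite graph is matching unique if no finite graph is comatching with it. (Every finite graph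
is isomorphic to one whose vertex type lies in `Type`.) -/
def SimpleGraph.MatchingUnique {V : Type*} [Finite V] (G : SimpleGraph V) : Prop :=
  ∀ (W : Type) [Finite W] (H : SimpleGraph W), ¬ G.Comatching H

/-- The graph obtained from `G` by adding one new vertex `none`, joined exactly to the vertices
in `S`. -/
def SimpleGraph.addVertex {V : Type*} (G : SimpleGraph V) (S : Set V) :
    SimpleGraph (Option V) where
  Adj
    | some a, some b => G.Adj a b
    | none, some b => b ∈ S
    | some a, none => a ∈ S
    | none, none => False
  symm := ⟨by
    rintro (_ | a) (_ | b) h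
    · exact h
    · exact h
    · exact h
    · exact G.symm.symm _ _ h⟩
  loopless := ⟨by
    rintro (_ | a) h
    · exact h
    · exact G.loopless.irrefl a h⟩

/-- The star `K_{1,k}`; its center is `Sum.inl 0` and its leaves are the `Sum.inr i`. -/
abbrev starK (k : ℕ) : SimpleGraph (Fin 1 ⊕ Fin k) := completeBipartiteGraph (Fin 1) (Fin k)

/-- The edgeless graph `t K_1`. -/
abbrev isolatedK (t : ℕ) : SimpleGraph (Fin t) := ⊥

/-- The graph `K(k, t; ℓ)` (for `1 ≤ ℓ ≤ k`): a new vertex is added to `K_{1,k} ∪ t K_1` and joined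
to `ℓ` leaves of the star (not to its center) and to all `t` isolated vertices. -/
def graphK (k t ℓ : ℕ) : SimpleGraph (Option ((Fin 1 ⊕ Fin k) ⊕ Fin t)) :=
  (starK k ⊕g isolatedK t).addVertex
    ({v | ∃ i : Fin k, (i : ℕ) < ℓ ∧ v = Sum.inl (Sum.inr i)} ∪ Set.range Sum.inr)

/-- The graph `L(t, ℓ)` (for `1 ≤ ℓ ≤ 3`): a new vertex is added to `K_3 ∪ t K_1` and joined to `ℓ`
vertices of the triangle and to all `t` isolated vertices. -/
def graphL (t ℓ : ℕ) : SimpleGraph (Option (Fin 3 ⊕ Fin t)) :=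
  ((⊤ : SimpleGraph (Fin 3)) ⊕g isolatedK t).addVertex
    ({v | ∃ i : Fin 3, (i : ℕ) < ℓ ∧ v = Sum.inl i} ∪ Set.range Sum.inr)

/-- The house: a 5-cycle with one chord. -/
def houseGraph : SimpleGraph (Fin 5) := SimpleGraph.cycleGraph 5 ⊔ SimpleGraph.edge 0 2

/-!
The matching polynomial of a graph determines the number `n` of vertices and all matching numbers
(`SimpleGraph.matchingNumber_eq_of_matchingPoly_eq`). In `K(k, t; ℓ)` the centre of the star and the
added vertex, of degrees `a = k` and `b = ℓ + t`, are nonadjacent, cover all edges, and have `ℓ`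
common neighbours. So it has `a + b - ℓ + 2` vertices, `a + b` edges, `a * b - ℓ` matchings of size
two and none of size three.

A graph with an edge and without three disjoint edges is covered by two vertices, or by a vertex and
a triangle, or consists of two disjoint triangles, or has all edges within five vertices
(`SimpleGraph.NoThreeMatching.classification`). The numbers of edges and of `2`-matchings depend
only on the degrees (`SimpleGraph.two_mul_matchingNumber_two_add`), and are compared with those of
`K(k, t; ℓ)` in each case.

* A cover by two nonadjacent vertices of degrees `p`, `q` with `s` common neighbours has
  `p + q = a + b` and `p * q - s = a * b - ℓ`. The number of vertices gives `s ≥ ℓ`. As `a` and `b`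
  differ by at most one, `p * q ≤ a * b`, so `s = ℓ` and `{p, q} = {a, b}`, and these numbers
  determine the graph (`SimpleGraph.IsPairCover.nonempty_iso`). An adjacent pair leaves only paths
  with three or four vertices, where the pair can be replaced by a nonadjacent one.
* For a vertex with `p` neighbours outside a triangle and `j` in it, the equations give
  `(a - 3) * (b - 3) = ℓ - 2 * j` and `ℓ ≤ j + 1`, which leaves exceptional triples only.
* Two triangles would need `ℓ = 0`.
* For five vertices the Cauchy-Schwarz inequality for the degrees leaves exceptional triples only.

Conversely, the listed graphs share these numbers with the exceptional `K(k, t; ℓ)`, and are not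
isomorphic to them because no two vertices cover all their edges (`graphK_comatching`).
-/

namespace SimpleGraph

/-- `G` has no three pairwise disjoint edges. -/
def NoThreeMatching {V : Type*} (G : SimpleGraph V) : Prop :=
  ∀ a b c d e f : V, G.Adj a b → G.Adj c d → G.Adj e f →
    a ≠ c → a ≠ d → a ≠ e → a ≠ f → b ≠ c → b ≠ d → b ≠ e → b ≠ f →
    c ≠ e → c ≠ f → d ≠ e → d ≠ f → False

/-! ### Counting matchings with one, two and three edges -/

section Counting

variable {V : Type*} [Fintype V] [DecidableEq V] (G : SimpleGraph V) [DecidableRel G.Adj]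

theorem matchingNumber_eq_card (k : ℕ) :
    G.matchingNumber k = ((G.edgeFinset.powersetCard k).filter fun M =>
      ∀ e ∈ M, ∀ f ∈ M, e ≠ f → ∀ v : V, ¬ (v ∈ e ∧ v ∈ f)).card := by
  rw [matchingNumber, ← Set.ncard_coe_finset]
  congr 1
  ext M
  simp only [IsKMatching, Set.mem_ofPred_eq, Finset.coe_filter, Finset.mem_powersetCard,
    Finset.subset_iff, mem_edgeFinset, and_assoc]

theorem matchingNumber_zero : G.matchingNumber 0 = 1 := by
  rw [matchingNumber_eq_card]
  simp [Finset.filter_singleton]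

theorem matchingNumber_one : G.matchingNumber 1 = G.edgeFinset.card := by
  rw [matchingNumber_eq_card, Finset.filter_true_of_mem, Finset.card_powersetCard,
    Nat.choose_one_right]
  intro M hM e he f hf hne
  obtain ⟨x, rfl⟩ := Finset.card_eq_one.1 (Finset.mem_powersetCard.1 hM).2
  simp_all

/-- Two distinct edges are disjoint or share exactly one vertex, so the pairs of edges split into
the `2`-matchings and, for each vertex, the pairs of edges at that vertex. -/
theorem matchingNumber_two_add :
    G.matchingNumber 2 + ∑ v, (G.degree v).choose 2 = (G.edgeFinset.card).choose 2 := by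
  rw [matchingNumber_eq_card, ← Finset.card_powersetCard 2 G.edgeFinset]
  have h1 : ∑ v, (G.degree v).choose 2 =
      (Finset.univ.biUnion fun v => (G.incidenceFinset v).powersetCard 2).card := by
    rw [Finset.card_biUnion]
    · simp
    · intro v _ w _ hvw
      rw [Function.onFun, Finset.disjoint_left]
      intro M hM hM'
      rw [Finset.mem_powersetCard] at hM hM'
      obtain ⟨e, f, hef, rfl⟩ := Finset.card_eq_two.1 hM.2
      apply hef
      have he := hM.1 (Finset.mem_insert_self e _)
      have hf := hM.1 (Finset.mem_insert_of_mem (Finset.mem_singleton_self f))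
      have he' := hM'.1 (Finset.mem_insert_self e _)
      have hf' := hM'.1 (Finset.mem_insert_of_mem (Finset.mem_singleton_self f))
      rw [mem_incidenceFinset] at he hf he' hf'
      rw [(Sym2.mem_and_mem_iff hvw).1 ⟨he.2, he'.2⟩, (Sym2.mem_and_mem_iff hvw).1 ⟨hf.2, hf'.2⟩]
  rw [h1, ← Finset.card_filter_add_card_filter_not (s := G.edgeFinset.powersetCard 2) (fun M =>
      ∀ e ∈ M, ∀ f ∈ M, e ≠ f → ∀ v : V, ¬ (v ∈ e ∧ v ∈ f))]
  congr 2
  ext M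
  simp only [Finset.mem_biUnion, Finset.mem_univ, true_and, Finset.mem_powersetCard,
    Finset.mem_filter]
  constructor
  · rintro ⟨v, hM, hc⟩
    refine ⟨⟨fun e he => ?_, hc⟩, fun hdis => ?_⟩
    · have := hM he
      rw [mem_incidenceFinset] at this
      exact mem_edgeFinset.2 this.1
    · obtain ⟨e, f, hef, rfl⟩ := Finset.card_eq_two.1 hc
      have he := hM (Finset.mem_insert_self e _)
      have hf := hM (Finset.mem_insert_of_mem (Finset.mem_singleton_self f))
      rw [mem_incidenceFinset] at he hf
      exact hdis e (by simp) f (by simp) hef v ⟨he.2, hf.2⟩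
  · rintro ⟨⟨hM, hc⟩, hdis⟩
    push Not at hdis
    obtain ⟨e, he, f, hf, hef, v, hve, hvf⟩ := hdis
    refine ⟨v, ?_, hc⟩
    have : M = {e, f} := by
      refine (Finset.eq_of_subset_of_card_le ?_ ?_).symm
      · intro x; simp only [Finset.mem_insert, Finset.mem_singleton]
        rintro (rfl | rfl) <;> assumption
      · rw [hc, Finset.card_pair hef]
    intro x hx
    rw [mem_incidenceFinset]
    refine ⟨mem_edgeFinset.1 (hM hx), ?_⟩
    rw [this] at hx
    simp only [Finset.mem_insert, Finset.mem_singleton] at hx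
    rcases hx with rfl | rfl <;> assumption

/-- The degree sequence determines the number of `2`-matchings. -/
theorem two_mul_matchingNumber_two_add :
    2 * G.matchingNumber 2 + ∑ v, G.degree v ^ 2 =
      G.edgeFinset.card ^ 2 + G.edgeFinset.card := by
  have key (a : ℕ) : a ^ 2 = 2 * a.choose 2 + a := by
    rw [Nat.choose_two_right, Nat.mul_div_cancel' (Nat.even_mul_pred_self a).two_dvd]
    cases a <;> simp; ring
  have h1 := G.matchingNumber_two_add
  have h2 := G.sum_degrees_eq_twice_card_edges
  rw [key G.edgeFinset.card, ← h1]
  simp only [key (G.degree _), Finset.sum_add_distrib, ← Finset.mul_sum, h2]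
  ring
theorem matchingNumber_three_eq_zero_iff : G.matchingNumber 3 = 0 ↔ G.NoThreeMatching := by
  classical
  rw [matchingNumber_eq_card, Finset.card_eq_zero, Finset.filter_eq_empty_iff]
  constructor
  · intro h a b c d e f h1 h2 h3 n1 n2 n3 n4 n5 n6 n7 n8 n9 n10 n11 n12
    refine @h {s(a, b), s(c, d), s(e, f)} ?_ ?_
    · rw [Finset.mem_powersetCard]
      constructor
      · intro x hx
        simp only [Finset.mem_insert, Finset.mem_singleton] at hx
        rcases hx with rfl | rfl | rfl <;> simpa
      · apply Finset.card_eq_three.2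
        refine ⟨_, _, _, ?_, ?_, ?_, rfl⟩ <;> simp <;> tauto
    · intro x hx y hy hxy v hv
      simp only [Finset.mem_insert, Finset.mem_singleton] at hx hy
      rcases hx with rfl | rfl | rfl <;> rcases hy with rfl | rfl | rfl <;>
        simp only [Sym2.mem_iff, ne_eq, not_true_eq_false] at hv hxy <;> grind
  · intro h M hM hdis
    rw [Finset.mem_powersetCard] at hM
    obtain ⟨x, y, z, hxy, hxz, hyz, rfl⟩ := Finset.card_eq_three.1 hM.2
    have d1 := hdis x (by simp) y (by simp) hxy
    have d2 := hdis x (by simp) z (by simp) hxz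
    have d3 := hdis y (by simp) z (by simp) hyz
    have e1 := hM.1 (show x ∈ _ by simp)
    have e2 := hM.1 (show y ∈ _ by simp)
    have e3 := hM.1 (show z ∈ _ by simp)
    clear hdis hM
    induction x with | _ a b
    induction y with | _ c d
    induction z with | _ e f
    simp only [mem_edgeFinset, mem_edgeSet, Sym2.mem_iff] at *
    refine h a b c d e f e1 e2 e3 ?_ ?_ ?_ ?_ ?_ ?_ ?_ ?_ ?_ ?_ ?_ ?_ <;> rintro rfl
    · exact d1 a (by simp)
    · exact d1 a (by simp)
    · exact d2 a (by simp)
    · exact d2 a (by simp)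
    · exact d1 b (by simp)
    · exact d1 b (by simp)
    · exact d2 b (by simp)
    · exact d2 b (by simp)
    · exact d3 c (by simp)
    · exact d3 c (by simp)
    · exact d3 d (by simp)
    · exact d3 d (by simp)

end Counting

section Vanishing

variable {V : Type*} (G : SimpleGraph V)

theorem matchingNumber_eq_zero_of_card_lt [Fintype V] {k : ℕ} (h : Fintype.card V < 2 * k) :
    G.matchingNumber k = 0 := by
  classical
  rw [matchingNumber_eq_card, Finset.card_eq_zero, Finset.filter_eq_empty_iff]
  intro M hM hdis
  rw [Finset.mem_powersetCard] at hM
  have h1 : (M.biUnion Sym2.toFinset).card = ∑ e ∈ M, e.toFinset.card := by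
    apply Finset.card_biUnion
    intro e he f hf hne
    rw [Function.onFun, Finset.disjoint_left]
    intro v hv hv'
    exact hdis e he f hf hne v ⟨Sym2.mem_toFinset.1 hv, Sym2.mem_toFinset.1 hv'⟩
  have h2 : ∑ e ∈ M, e.toFinset.card = ∑ e ∈ M, 2 := by
    refine Finset.sum_congr rfl fun e he => Sym2.card_toFinset_of_not_isDiag _ ?_
    exact G.not_isDiag_of_mem_edgeSet (mem_edgeFinset.1 (hM.1 he))
  have h3 := Finset.card_le_univ (M.biUnion Sym2.toFinset)
  rw [h1, h2, Finset.sum_const, hM.2, smul_eq_mul] at h3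
  omega


theorem matchingNumber_eq_zero_of_noThreeMatching [Finite V] (h : G.NoThreeMatching) {k : ℕ}
    (hk : 3 ≤ k) : G.matchingNumber k = 0 := by
  classical
  have := Fintype.ofFinite V
  have := Fintype.ofFinite V
  have h3 := (matchingNumber_three_eq_zero_iff G).2 h
  rw [matchingNumber_eq_card, Finset.card_eq_zero, Finset.filter_eq_empty_iff] at h3 ⊢
  intro M hM hdis
  rw [Finset.mem_powersetCard] at hM
  obtain ⟨N, hN, hc⟩ := Finset.exists_subset_card_eq (hM.2 ▸ hk)
  exact @h3 N (Finset.mem_powersetCard.2 ⟨hN.trans hM.1, hc⟩)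
    fun e he f hf => hdis e (hN he) f (hN hf)

end Vanishing

/-! ### Invariants determined by the matching polynomial -/

section Polynomial

variable {V W : Type*} [Finite V] [Finite W] (G : SimpleGraph V) (H : SimpleGraph W)

theorem coeff_matchingPoly {j : ℕ} (hj : 2 * j ≤ Nat.card V) :
    G.matchingPoly.coeff (Nat.card V - 2 * j) = (-1) ^ j * (G.matchingNumber j : ℤ) := by
  rw [matchingPoly, finsetSum_coeff, Finset.sum_eq_single j]
  · rw [coeff_C_mul_X_pow, if_pos rfl]
  · intro i hi hij
    rw [Finset.mem_range] at hi
    rw [coeff_C_mul_X_pow, if_neg]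
    omega
  · intro hj'
    rw [Finset.mem_range] at hj'
    omega

/-- The coefficient of degree `n` is `m(G, 0) = 1`. -/
theorem natDegree_matchingPoly : G.matchingPoly.natDegree = Nat.card V := by
  have := Fintype.ofFinite V
  classical
  apply natDegree_eq_of_le_of_coeff_ne_zero
  · apply natDegree_sum_le_of_forall_le
    intro i _
    exact (natDegree_C_mul_X_pow_le _ _).trans (Nat.sub_le _ _)
  · have := G.coeff_matchingPoly (j := 0) (by simp)
    simp [matchingNumber_zero] at this
    simp [this]

variable {G H}

theorem card_eq_of_matchingPoly_eq (h : G.matchingPoly = H.matchingPoly) :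
    Nat.card V = Nat.card W := by
  rw [← G.natDegree_matchingPoly, h, natDegree_matchingPoly]

/-- The matching polynomial determines the number of `k`-matchings for every `k`. -/
theorem matchingNumber_eq_of_matchingPoly_eq (h : G.matchingPoly = H.matchingPoly) (j : ℕ) :
    G.matchingNumber j = H.matchingNumber j := by
  have := Fintype.ofFinite V
  have := Fintype.ofFinite W
  have hc := card_eq_of_matchingPoly_eq h
  by_cases hj : 2 * j ≤ Nat.card V
  · have h1 := G.coeff_matchingPoly hj
    have h2 := H.coeff_matchingPoly (hc ▸ hj)
    rw [← h, ← hc, h1] at h2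
    have := mul_left_cancel₀ (pow_ne_zero j (by norm_num)) h2
    exact_mod_cast this
  · rw [matchingNumber_eq_zero_of_card_lt, matchingNumber_eq_zero_of_card_lt] <;>
      rw [← Nat.card_eq_fintype_card] <;> omega

theorem matchingPoly_eq_of_noThreeMatching (hn : Nat.card V = Nat.card W)
    (h1 : G.matchingNumber 1 = H.matchingNumber 1) (h2 : G.matchingNumber 2 = H.matchingNumber 2)
    (hG : G.NoThreeMatching) (hH : H.NoThreeMatching) : G.matchingPoly = H.matchingPoly := by
  have := Fintype.ofFinite V
  have := Fintype.ofFinite W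
  classical
  rw [matchingPoly, matchingPoly, hn]
  refine Finset.sum_congr rfl fun k _ => ?_
  have : G.matchingNumber k = H.matchingNumber k := by
    match k with
    | 0 => rw [matchingNumber_zero, matchingNumber_zero]
    | 1 => exact h1
    | 2 => exact h2
    | k + 3 =>
      rw [matchingNumber_eq_zero_of_noThreeMatching _ hG (by omega),
        matchingNumber_eq_zero_of_noThreeMatching _ hH (by omega)]
  rw [this]

end Polynomial

/-! ### Graphs without three disjoint edges -/

/-- Every edge of `G` contains one of the two distinct vertices `u` and `v`. -/
def IsPairCover {V : Type*} (G : SimpleGraph V) (u v : V) : Prop :=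
  u ≠ v ∧ ∀ x y, G.Adj x y → x = u ∨ x = v ∨ y = u ∨ y = v

/-- The vertices `x`, `y`, `z` form a triangle of `G` that avoids `v`, and every edge of `G`
contains `v` or lies in that triangle. -/
def IsVertexTriangle {V : Type*} (G : SimpleGraph V) (v x y z : V) : Prop :=
  v ≠ x ∧ v ≠ y ∧ v ≠ z ∧ G.Adj x y ∧ G.Adj x z ∧ G.Adj y z ∧
    ∀ a b, G.Adj a b → a = v ∨ b = v ∨ ((a = x ∨ a = y ∨ a = z) ∧ (b = x ∨ b = y ∨ b = z))

/-- The edges of `G` are those of two disjoint triangles `a b w` and `c d w'`. -/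
def IsTwoTriangles {V : Type*} (G : SimpleGraph V) (a b w c d w' : V) : Prop :=
  [a, b, w, c, d, w'].Nodup ∧ ∀ x y, G.Adj x y ↔ x ≠ y ∧
    (((x = a ∨ x = b ∨ x = w) ∧ (y = a ∨ y = b ∨ y = w)) ∨
      ((x = c ∨ x = d ∨ x = w') ∧ (y = c ∨ y = d ∨ y = w')))

theorem IsPairCover.noThreeMatching {V : Type*} {G : SimpleGraph V} {u v : V}
    (h : G.IsPairCover u v) : G.NoThreeMatching := by
  intro a b c d e f h1 h2 h3
  have := h.2 a b h1
  have := h.2 c d h2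
  have := h.2 e f h3
  grind

theorem IsVertexTriangle.noThreeMatching {V : Type*} {G : SimpleGraph V} {v x y z : V}
    (h : G.IsVertexTriangle v x y z) : G.NoThreeMatching := by
  intro a b c d e f h1 h2 h3
  obtain ⟨-, -, -, -, -, -, h⟩ := h
  have := h a b h1
  have := h c d h2
  have := h e f h3
  have := h1.ne
  have := h2.ne
  have := h3.ne
  clear h
  grind

variable {V : Type*} {G : SimpleGraph V}

namespace NoThreeMatching

/-- An edge `c d` and a disjoint triangle `a b w`, where `d` has no neighbours elsewhere. -/
theorem of_triangle_of_edge (h : G.NoThreeMatching) {a b c d w : V}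
    (hab : G.Adj a b) (hcd : G.Adj c d) (hac : a ≠ c) (had : a ≠ d) (hbc : b ≠ c) (hbd : b ≠ d)
    (haw : G.Adj a w) (hbw : G.Adj b w) (hwc : w ≠ c) (hwd : w ≠ d)
    (hd : ∀ x, G.Adj d x → x = a ∨ x = b ∨ x = c) :
    (∃ v x y z, G.IsVertexTriangle v x y z) ∨
      ∃ S : Finset V, S.card = 5 ∧ ∀ x y, G.Adj x y → x ∈ S := by
  classical
  have e1 := hab.ne
  have e2 := hcd.ne
  have e3 := haw.ne
  have e4 := hbw.ne
  -- an edge missing all of `a`, `b`, `c`, `d` would extend the matching `a b`, `c d`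
  have hout : ∀ x y, G.Adj x y → x = a ∨ x = b ∨ x = c ∨ x = d ∨
      y = a ∨ y = b ∨ y = c ∨ y = d := by
    intro x y hxy
    have := h a b c d x y hab hcd hxy
    grind
  have hA : ∀ x, G.Adj a x → x = b ∨ x = c ∨ x = d ∨ x = w := by
    intro x hx
    have := h a x b w c d hx hbw hcd
    have := hx.ne
    grind
  have hB : ∀ x, G.Adj b x → x = a ∨ x = c ∨ x = d ∨ x = w := by
    intro x hx
    have := h b x a w c d hx haw hcd
    have := hx.ne
    grind
  by_cases hc : ∃ w', G.Adj c w' ∧ w' ≠ a ∧ w' ≠ b ∧ w' ≠ d ∧ w' ≠ w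
  · left
    obtain ⟨w', hcw, n1, n2, n3, n4⟩ := hc
    have := hcw.ne
    refine ⟨c, a, b, w, hac.symm, hbc.symm, hwc.symm, hab, haw, hbw, ?_⟩
    -- an edge from `d` to the triangle would leave an edge of the triangle, disjoint from `c w'`
    have f1 : ¬ G.Adj a d := fun had' => by
      have := h a d b w c w' had' hbw hcw
      grind
    have f2 : ¬ G.Adj b d := fun hbd' => by
      have := h b d a w c w' hbd' haw hcw
      grind
    have sym := G.adj_comm
    intro x y hxy
    have := hout x y hxy
    have := hxy.symm
    grind
  · right
    refine ⟨{a, b, c, d, w}, ?_, ?_⟩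
    · grind [Finset.card_insert_of_notMem, Finset.card_singleton]
    · push Not at hc
      intro x y hxy
      have := hout x y hxy
      have := hxy.symm
      simp only [Finset.mem_insert, Finset.mem_singleton]
      grind

/-- Two disjoint edges `a b` and `c d`, where `b` and `d` have no neighbours elsewhere. -/
theorem of_two_edges (h : G.NoThreeMatching) {a b c d : V}
    (hab : G.Adj a b) (hcd : G.Adj c d) (hac : a ≠ c) (had : a ≠ d) (hbc : b ≠ c) (hbd : b ≠ d)
    (hb : ∀ x, G.Adj b x → x = a ∨ x = c ∨ x = d) (hd : ∀ x, G.Adj d x → x = a ∨ x = b ∨ x = c) :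
    (∃ u v, G.IsPairCover u v) ∨ (∃ v x y z, G.IsVertexTriangle v x y z) ∨
      ∃ S : Finset V, S.card = 5 ∧ ∀ x y, G.Adj x y → x ∈ S := by
  classical
  have e1 := hab.ne
  have e2 := hcd.ne
  have hout : ∀ x y, G.Adj x y → x = a ∨ x = b ∨ x = c ∨ x = d ∨
      y = a ∨ y = b ∨ y = c ∨ y = d := by
    intro x y hxy
    have := h a b c d x y hab hcd hxy
    grind
  -- without the edge `b d`, the vertices `a` and `c` cover everything
  by_cases hbd' : G.Adj b d
  swap
  · refine Or.inl ⟨a, c, hac, fun x y hxy => ?_⟩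
    have := hout x y hxy
    have := hxy.symm
    grind
  -- if `a` has no neighbours elsewhere, then every edge contains `c` or lies in `{a, b, d}`
  by_cases ha : ∃ w, G.Adj a w ∧ w ≠ b ∧ w ≠ c ∧ w ≠ d
  swap
  · push Not at ha
    by_cases hab' : G.Adj a d
    swap
    · refine Or.inl ⟨b, c, hbc, fun x y hxy => ?_⟩
      have := hout x y hxy
      have := hxy.symm
      grind
    refine Or.inr (Or.inl ⟨c, a, b, d, hac.symm, hbc.symm, e2, hab, hab', hbd', fun x y hxy => ?_⟩)
    have := hout x y hxy
    have := hxy.symm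
    grind
  by_cases hc : ∃ w, G.Adj c w ∧ w ≠ a ∧ w ≠ b ∧ w ≠ d
  swap
  · push Not at hc
    by_cases hcb' : G.Adj c b
    swap
    · refine Or.inl ⟨d, a, had.symm, fun x y hxy => ?_⟩
      have := hout x y hxy
      have := hxy.symm
      grind
    refine Or.inr (Or.inl ⟨a, c, d, b, hac, had, e1, hcd, hcb', hbd'.symm, fun x y hxy => ?_⟩)
    have := hout x y hxy
    have := hxy.symm
    grind
  obtain ⟨w, haw, n1, n2, n3⟩ := ha
  obtain ⟨w', hcw, m1, m2, m3⟩ := hc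
  have := haw.ne
  have := hcw.ne
  -- the edge `b d` extends by `a x` and `c y` if `x ≠ y` are elsewhere, so `a` and `c` share their
  -- only neighbour elsewhere
  have hw (x y : V) (hx : G.Adj a x) (hy : G.Adj c y) := h a x b d c y hx hbd' hy
  refine Or.inr (Or.inr ⟨{a, b, c, d, w}, ?_, fun x y hxy => ?_⟩)
  · grind [Finset.card_insert_of_notMem, Finset.card_singleton]
  · have := hout x y hxy
    have := hxy.symm
    have hA : ∀ x, G.Adj a x → x = b ∨ x = c ∨ x = d ∨ x = w := by
      intro x hx
      have h1 := hw w w' haw hcw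
      have h2 := hw x w' hx hcw
      have := hx.ne
      clear h hw hout
      grind
    have hC : ∀ x, G.Adj c x → x = a ∨ x = b ∨ x = d ∨ x = w := by
      intro x hx
      have h2 := hw w x haw hx
      have := hx.ne
      clear h hw hout hA
      grind
    have := G.ne_of_adj hxy
    simp only [Finset.mem_insert, Finset.mem_singleton]
    clear h hw hout hcw
    grind

/-- Two triangles that share at most the vertex `w = w'`. -/
theorem of_two_triangles (h : G.NoThreeMatching) {a b w c d w' : V}
    (hab : G.Adj a b) (haw : G.Adj a w) (hbw : G.Adj b w)
    (hcd : G.Adj c d) (hcw : G.Adj c w') (hdw : G.Adj d w')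
    (hac : a ≠ c) (had : a ≠ d) (hbc : b ≠ c) (hbd : b ≠ d)
    (hwc : w ≠ c) (hwd : w ≠ d) (hwa : w' ≠ a) (hwb : w' ≠ b) :
    (∃ a b w c d w', G.IsTwoTriangles a b w c d w') ∨
      ∃ S : Finset V, S.card = 5 ∧ ∀ x y, G.Adj x y → x ∈ S := by
  classical
  have e1 := hab.ne
  have e2 := hcd.ne
  have e3 := haw.ne
  have e4 := hbw.ne
  have e5 := hcw.ne
  have e6 := hdw.ne
  have hA : ∀ x, G.Adj a x → x = b ∨ x = c ∨ x = d ∨ x = w := by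
    intro x hx
    have := h a x b w c d hx hbw hcd
    have := hx.ne
    grind
  have hB : ∀ x, G.Adj b x → x = a ∨ x = c ∨ x = d ∨ x = w := by
    intro x hx
    have := h b x a w c d hx haw hcd
    have := hx.ne
    grind
  have hC : ∀ x, G.Adj c x → x = a ∨ x = b ∨ x = d ∨ x = w' := by
    intro x hx
    have := h c x d w' a b hx hdw hab
    have := hx.ne
    grind
  have hD : ∀ x, G.Adj d x → x = a ∨ x = b ∨ x = c ∨ x = w' := by
    intro x hx
    have := h d x c w' a b hx hcw hab
    have := hx.ne
    grind
  have hout : ∀ x y, G.Adj x y → x = a ∨ x = b ∨ x = c ∨ x = d ∨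
      y = a ∨ y = b ∨ y = c ∨ y = d := by
    intro x y hxy
    have := h a b c d x y hab hcd hxy
    grind
  rcases eq_or_ne w w' with rfl | hww
  · refine Or.inr ⟨{a, b, c, d, w}, ?_, fun x y hxy => ?_⟩
    · grind [Finset.card_insert_of_notMem, Finset.card_singleton]
    · have := hout x y hxy
      have := hxy.symm
      simp only [Finset.mem_insert, Finset.mem_singleton]
      clear h hout
      grind
  · -- an edge between the two triangles leaves an edge of each of them to extend it
    have cross {x x' x'' y y' y'' : V} (hx : G.Adj x' x'') (hy : G.Adj y' y'') (hxy : G.Adj x y) :=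
      h x y x' x'' y' y'' hxy hx hy
    have n1 : ¬ G.Adj a c := fun H => by have := cross hbw hdw H; grind
    have n2 : ¬ G.Adj a d := fun H => by have := cross hbw hcw H; grind
    have n4 : ¬ G.Adj b c := fun H => by have := cross haw hdw H; grind
    have n5 : ¬ G.Adj b d := fun H => by have := cross haw hcw H; grind
    refine Or.inl ⟨a, b, w, c, d, w', by simp; grind, fun x y => ?_⟩
    have sym := G.adj_comm
    constructor
    · intro hxy
      have := hout x y hxy
      have := hxy.symm
      have := hxy.ne
      clear h hout cross
      grind
    · clear h hout cross
      grind

/-- A graph with at least one edge and without three disjoint edges is covered by two vertices,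
or by a vertex and a triangle, or consists of two disjoint triangles, or has all its edges within
five vertices. For disjoint edges `a b` and `c d`, the cases depend on whether `a b` and `c d` form
triangles with outside vertices. -/
theorem classification (h : G.NoThreeMatching) {a b : V} (hab : G.Adj a b) :
    (∃ u v, G.IsPairCover u v) ∨ (∃ v x y z, G.IsVertexTriangle v x y z) ∨
      (∃ a b w c d w', G.IsTwoTriangles a b w c d w') ∨
      ∃ S : Finset V, S.card = 5 ∧ ∀ x y, G.Adj x y → x ∈ S := by
  by_cases hcd : ∃ c d, G.Adj c d ∧ a ≠ c ∧ a ≠ d ∧ b ≠ c ∧ b ≠ d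
  swap
  · push Not at hcd
    refine Or.inl ⟨a, b, hab.ne, fun x y hxy => ?_⟩
    have := hcd x y hxy
    grind
  obtain ⟨c, d, hcd, hac, had, hbc, hbd⟩ := hcd
  have e1 := hab.ne
  have e2 := hcd.ne
  have hout : ∀ x y, G.Adj x y → x = a ∨ x = b ∨ x = c ∨ x = d ∨
      y = a ∨ y = b ∨ y = c ∨ y = d := by
    intro x y hxy
    have := h a b c d x y hab hcd hxy
    grind
  -- outside neighbours of the two ends of an edge of the matching coincide
  have F1 (x y : V) (hx : G.Adj a x) (hy : G.Adj b y) := h a x b y c d hx hy hcd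
  have F2 (x y : V) (hx : G.Adj c x) (hy : G.Adj d y) := h c x d y a b hx hy hab
  by_cases hA : ∃ w, G.Adj a w ∧ G.Adj b w ∧ w ≠ c ∧ w ≠ d
  · obtain ⟨w, haw, hbw, hwc, hwd⟩ := hA
    have := haw.ne
    have := hbw.ne
    by_cases hC : ∃ w', G.Adj c w' ∧ G.Adj d w' ∧ w' ≠ a ∧ w' ≠ b
    · obtain ⟨w', hcw, hdw, hwa', hwb'⟩ := hC
      have := hcw.ne
      have := hdw.ne
      exact .inr (.inr
        (h.of_two_triangles hab haw hbw hcd hcw hdw hac had hbc hbd hwc hwd hwa' hwb'))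
    · push Not at hC
      by_cases hd : ∀ x, G.Adj d x → x = a ∨ x = b ∨ x = c
      · refine .inr (Or.imp_right .inr ?_)
        exact h.of_triangle_of_edge hab hcd hac had hbc hbd haw hbw hwc hwd hd
      · have hc : ∀ x, G.Adj c x → x = a ∨ x = b ∨ x = d := by
          push Not at hd
          obtain ⟨y, hy, _⟩ := hd
          intro x hx
          have := F2 x y hx hy
          have := hx.ne
          have := hy.ne
          grind
        refine .inr (Or.imp_right .inr ?_)
        exact h.of_triangle_of_edge hab hcd.symm had hac hbd hbc haw hbw hwd hwc hc
  · push Not at hA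
    by_cases hC : ∃ w', G.Adj c w' ∧ G.Adj d w' ∧ w' ≠ a ∧ w' ≠ b
    · obtain ⟨w, hcw, hdw, hwa, hwb⟩ := hC
      by_cases hb : ∀ x, G.Adj b x → x = c ∨ x = d ∨ x = a
      · refine .inr (Or.imp_right .inr ?_)
        exact h.of_triangle_of_edge hcd hab hac.symm hbc.symm had.symm hbd.symm hcw hdw hwa hwb hb
      · have ha : ∀ x, G.Adj a x → x = c ∨ x = d ∨ x = b := by
          push Not at hb
          obtain ⟨y, hy, _⟩ := hb
          intro x hx
          have := F1 x y hx hy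
          have := hx.ne
          have := hy.ne
          grind
        refine .inr (Or.imp_right .inr ?_)
        exact h.of_triangle_of_edge hcd hab.symm hbc.symm hac.symm hbd.symm had.symm hcw hdw
          hwb hwa ha
    · push Not at hC
      have ha : (∀ x, G.Adj a x → x = b ∨ x = c ∨ x = d) ∨
          ∀ x, G.Adj b x → x = a ∨ x = c ∨ x = d := by
        by_contra! hne
        obtain ⟨⟨x, hx, _⟩, ⟨y, hy, _⟩⟩ := hne
        have := F1 x y hx hy
        have := hx.ne
        have := hy.ne
        grind
      have hc : (∀ x, G.Adj c x → x = a ∨ x = b ∨ x = d) ∨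
          ∀ x, G.Adj d x → x = a ∨ x = b ∨ x = c := by
        by_contra! hne
        obtain ⟨⟨x, hx, _⟩, ⟨y, hy, _⟩⟩ := hne
        have := F2 x y hx hy
        have := hx.ne
        have := hy.ne
        grind
      rcases ha with ha | hb <;> rcases hc with hc | hd
      · refine Or.imp_right (Or.imp_right .inr) ?_
        exact h.of_two_edges hab.symm hcd.symm hbd hbc had hac (by grind) (by grind)
      · refine Or.imp_right (Or.imp_right .inr) ?_
        exact h.of_two_edges hab.symm hcd hbc hbd hac had (by grind) (by grind)
      · refine Or.imp_right (Or.imp_right .inr) ?_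
        exact h.of_two_edges hab hcd.symm had hac hbd hbc (by grind) (by grind)
      · refine Or.imp_right (Or.imp_right .inr) ?_
        exact h.of_two_edges hab hcd hac had hbc hbd (by grind) (by grind)

end NoThreeMatching
end SimpleGraph

namespace SimpleGraph

/-! ### Graphs covered by two vertices -/

section PairCover

variable {V : Type*} {G : SimpleGraph V} {u v : V}

theorem IsPairCover.symm (h : G.IsPairCover u v) : G.IsPairCover v u :=
  ⟨h.1.symm, fun x y hxy => by have := h.2 x y hxy; tauto⟩

variable [Fintype V] [DecidableEq V] [DecidableRel G.Adj]

theorem IsPairCover.degree_eq (h : G.IsPairCover u v) {w : V} (hu : w ≠ u) (hv : w ≠ v) :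
    G.degree w = (if G.Adj u w then 1 else 0) + if G.Adj v w then 1 else 0 := by
  have h1 : G.neighborFinset w =
      (if G.Adj u w then {u} else ∅) ∪ if G.Adj v w then {v} else ∅ := by
    ext x
    have h2 := fun hx => h.2 w x hx
    have h3 := G.adj_comm u w
    have h4 := G.adj_comm v w
    rw [mem_neighborFinset]
    grind
  have huv := h.1
  rw [← card_neighborFinset_eq_degree, h1]
  split_ifs <;> simp [huv]

variable (G u v) in
theorem card_filter_adj_and_ne :
    (Finset.univ.filter fun w => G.Adj u w ∧ w ≠ v).card + (if G.Adj u v then 1 else 0) =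
      G.degree u := by
  have h1 : (Finset.univ.filter fun w => G.Adj u w ∧ w ≠ v) = (G.neighborFinset u).erase v := by
    ext w; simp [and_comm]
  rw [h1, ← card_neighborFinset_eq_degree]
  split_ifs with h
  · exact Finset.card_erase_add_one ((G.mem_neighborFinset u v).2 h)
  · rw [Finset.erase_eq_of_notMem fun h' => h ((G.mem_neighborFinset u v).1 h'), add_zero]

/-- The first invariants of a graph covered by `u` and `v`, where `u` has `p` neighbours other than
`v`, `v` has `q` neighbours other than `u`, and `s` vertices are adjacent to both. -/
theorem IsPairCover.invariants (h : G.IsPairCover u v) {p q s e : ℕ}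
    (hp : (Finset.univ.filter fun w => G.Adj u w ∧ w ≠ v).card = p)
    (hq : (Finset.univ.filter fun w => G.Adj v w ∧ w ≠ u).card = q)
    (hs : (Finset.univ.filter fun w => G.Adj u w ∧ G.Adj v w).card = s)
    (he : (if G.Adj u v then 1 else 0) = e) :
    G.matchingNumber 1 = p + q + e ∧ G.matchingNumber 2 + s = p * q ∧
      p + q + 2 ≤ Fintype.card V + s := by
  have huv := h.1
  have hdu := G.card_filter_adj_and_ne u v
  have hdv := G.card_filter_adj_and_ne v u
  rw [hp, he] at hdu
  simp only [G.adj_comm v u] at hdv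
  rw [hq, he] at hdv
  set R := (Finset.univ.erase u).erase v with hR
  have hv : v ∈ Finset.univ.erase u := by simp [huv.symm]
  have split (f : V → ℕ) : ∑ w, f w = f u + (f v + ∑ w ∈ R, f w) := by
    rw [hR, Finset.add_sum_erase _ _ hv, Finset.add_sum_erase _ _ (Finset.mem_univ u)]
  have hmem {w : V} (hw : w ∈ R) : w ≠ u ∧ w ≠ v := by
    simp only [hR, Finset.mem_erase, Finset.mem_univ, and_true] at hw
    tauto
  have hp' : ∑ w ∈ R, (if G.Adj u w then 1 else 0) = p := by
    rw [← hp, ← Finset.card_filter]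
    congr 1
    ext w
    have := G.ne_of_adj (a := u) (b := w)
    simp only [hR, Finset.mem_filter, Finset.mem_erase, Finset.mem_univ, and_true, true_and]
    grind
  have hq' : ∑ w ∈ R, (if G.Adj v w then 1 else 0) = q := by
    rw [← hq, ← Finset.card_filter]
    congr 1
    ext w
    have := G.ne_of_adj (a := v) (b := w)
    simp only [hR, Finset.mem_filter, Finset.mem_erase, Finset.mem_univ, and_true, true_and]
    grind
  have hs' : ∑ w ∈ R, (if G.Adj u w then 1 else 0) * (if G.Adj v w then 1 else 0) = s := by
    have : ∀ w ∈ R, (if G.Adj u w then 1 else 0) * (if G.Adj v w then 1 else 0) =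
        if G.Adj u w ∧ G.Adj v w then 1 else 0 := by
      intro w _
      split_ifs <;> simp_all
    rw [Finset.sum_congr rfl this, ← hs, ← Finset.card_filter]
    congr 1
    ext w
    have := G.ne_of_adj (a := v) (b := w)
    have := G.ne_of_adj (a := u) (b := w)
    simp only [hR, Finset.mem_filter, Finset.mem_erase, Finset.mem_univ, and_true, true_and]
    grind
  have hcard : R.card + 2 = Fintype.card V := by
    rw [hR, Finset.card_erase_of_mem hv, Finset.card_erase_of_mem (Finset.mem_univ u),
      Finset.card_univ]
    have : 1 < Fintype.card V := Fintype.one_lt_card_iff.2 ⟨u, v, huv⟩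
    omega
  have hdeg {w : V} (hw : w ∈ R) := h.degree_eq (hmem hw).1 (hmem hw).2
  have hm : G.edgeFinset.card = p + q + e := by
    have h1 := G.sum_degrees_eq_twice_card_edges
    rw [split, Finset.sum_congr rfl fun w hw => hdeg hw, Finset.sum_add_distrib, hp', hq'] at h1
    omega
  refine ⟨by rw [matchingNumber_one, hm], ?_, ?_⟩
  · have h1 := G.two_mul_matchingNumber_two_add
    have h2 : ∀ w ∈ R, G.degree w ^ 2 = (if G.Adj u w then 1 else 0) +
        (if G.Adj v w then 1 else 0) +
        2 * ((if G.Adj u w then 1 else 0) * (if G.Adj v w then 1 else 0)) := by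
      intro w hw
      rw [hdeg hw]
      split_ifs <;> rfl
    rw [split, Finset.sum_congr rfl h2, Finset.sum_add_distrib, Finset.sum_add_distrib,
      ← Finset.mul_sum, hp', hq', hs', hm, ← hdu, ← hdv] at h1
    have he2 : e ^ 2 = e := by rw [← he]; split_ifs <;> rfl
    nlinarith
  · have h1 : ∑ w ∈ R, ((if G.Adj u w then 1 else 0) + (if G.Adj v w then 1 else 0)) ≤
        ∑ w ∈ R, (1 + (if G.Adj u w then 1 else 0) * (if G.Adj v w then 1 else 0)) := by
      apply Finset.sum_le_sum
      intro w _
      split_ifs <;> simp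
    rw [Finset.sum_add_distrib, Finset.sum_add_distrib, hp', hq', hs'] at h1
    simp only [Finset.sum_const, smul_eq_mul, mul_one] at h1
    omega

end PairCover

/-! ### Isomorphism of graphs covered by nonadjacent pairs -/

section Iso

/-- Two maps to the same type with equally large fibres differ by a bijection of their domains. -/
theorem exists_equiv_comp_eq {α β γ : Type*} [Fintype α] [Fintype β] [DecidableEq γ]
    (f : α → γ) (g : β → γ)
    (h : ∀ c, (Finset.univ.filter fun a => f a = c).card =
      (Finset.univ.filter fun b => g b = c).card) : ∃ e : α ≃ β, ∀ a, g (e a) = f a := by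
  have h' (c : γ) : Nonempty ({a // f a = c} ≃ {b // g b = c}) := by
    rw [← Fintype.card_eq, Fintype.card_subtype, Fintype.card_subtype]
    exact h c
  have F (c : γ) := (h' c).some
  refine ⟨(Equiv.sigmaFiberEquiv f).symm.trans
    ((Equiv.sigmaCongrRight F).trans (Equiv.sigmaFiberEquiv g)), fun a => ?_⟩
  exact (F (f a) ⟨a, rfl⟩).2

variable {V W : Type*} [DecidableEq V] [DecidableEq W]
  {G : SimpleGraph V} {H : SimpleGraph W} [DecidableRel G.Adj] [DecidableRel H.Adj]

/-- The role of a vertex `x` relative to a nonadjacent pair `u`, `v`: `0` for `u`, `1` for `v`,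
`2` for a common neighbour, `3` or `4` for a neighbour of only `u` or only `v`, and `5` for
any other vertex. -/
def pairColor (G : SimpleGraph V) [DecidableRel G.Adj] (u v x : V) : Fin 6 :=
  if x = u then 0 else if x = v then 1 else
    if G.Adj u x then (if G.Adj v x then 2 else 3) else if G.Adj v x then 4 else 5

/-- In a graph covered by a nonadjacent pair, adjacency depends only on the colours. -/
theorem IsPairCover.adj_iff_pairColor {u v : V} (h : G.IsPairCover u v) (hadj : ¬ G.Adj u v)
    (x y : V) : G.Adj x y ↔
      (G.pairColor u v x = 0 ∧ (G.pairColor u v y = 2 ∨ G.pairColor u v y = 3)) ∨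
      (G.pairColor u v x = 1 ∧ (G.pairColor u v y = 2 ∨ G.pairColor u v y = 4)) ∨
      (G.pairColor u v y = 0 ∧ (G.pairColor u v x = 2 ∨ G.pairColor u v x = 3)) ∨
      (G.pairColor u v y = 1 ∧ (G.pairColor u v x = 2 ∨ G.pairColor u v x = 4)) := by
  have hu := G.irrefl (v := u)
  have hv := G.irrefl (v := v)
  have huv := h.1
  have hc := h.2 x y
  have h1 := G.adj_comm u x
  have h2 := G.adj_comm v x
  have h3 := G.adj_comm u v
  simp only [pairColor]
  by_cases hxu : x = u
  · subst hxu
    clear h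
    grind
  by_cases hxv : x = v
  · subst hxv
    clear h
    grind
  by_cases hyu : y = u
  · subst hyu
    clear h
    grind
  by_cases hyv : y = v
  · subst hyv
    clear h
    grind
  have : ¬ G.Adj x y := fun hxy => by grind
  clear h
  grind

variable [Fintype V] [Fintype W]

theorem card_filter_pairColor {u v : V} (huv : u ≠ v) (hadj : ¬ G.Adj u v) {p q s : ℕ}
    (hp : G.degree u = p) (hq : G.degree v = q)
    (hs : (Finset.univ.filter fun w => G.Adj u w ∧ G.Adj v w).card = s) (c : Fin 6) :
    (Finset.univ.filter fun x => G.pairColor u v x = c).card =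
      ![1, 1, s, p - s, q - s, Fintype.card V + s - p - q - 2] c := by
  have hu := G.irrefl (v := u)
  have hv := G.irrefl (v := v)
  have hadj' : ¬ G.Adj v u := fun h => hadj h.symm
  have c0 : (Finset.univ.filter fun x => G.pairColor u v x = 0).card = 1 := by
    rw [Finset.card_eq_one]
    refine ⟨u, ?_⟩
    ext x
    simp only [pairColor, Finset.mem_singleton]
    grind
  have c1 : (Finset.univ.filter fun x => G.pairColor u v x = 1).card = 1 := by
    rw [Finset.card_eq_one]
    refine ⟨v, ?_⟩
    ext x
    simp only [pairColor, Finset.mem_singleton]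
    grind
  have c2 : (Finset.univ.filter fun x => G.pairColor u v x = 2).card = s := by
    rw [← hs]
    congr 1
    ext x
    simp only [pairColor, Finset.mem_filter, Finset.mem_univ, true_and]
    grind
  have c3 : (Finset.univ.filter fun x => G.pairColor u v x = 3).card + s = p := by
    rw [← hp, ← hs, ← card_neighborFinset_eq_degree, ← Finset.card_union_of_disjoint]
    · congr 1
      ext x
      simp only [pairColor, Finset.mem_union, Finset.mem_filter, Finset.mem_univ, true_and,
        mem_neighborFinset]
      grind
    · rw [Finset.disjoint_filter]
      intro x _
      simp only [pairColor]
      grind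
  have c4 : (Finset.univ.filter fun x => G.pairColor u v x = 4).card + s = q := by
    rw [← hq, ← hs, ← card_neighborFinset_eq_degree, ← Finset.card_union_of_disjoint]
    · congr 1
      ext x
      simp only [pairColor, Finset.mem_union, Finset.mem_filter, Finset.mem_univ, true_and,
        mem_neighborFinset]
      grind
    · rw [Finset.disjoint_filter]
      intro x _
      simp only [pairColor]
      grind
  have total := Finset.card_eq_sum_card_fiberwise (s := (Finset.univ : Finset V))
    (t := (Finset.univ : Finset (Fin 6))) (f := G.pairColor u v) (by simp)
  rw [Finset.card_univ, Fin.sum_univ_six] at total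
  fin_cases c
  · exact c0
  · exact c1
  · exact c2
  · change _ = p - s
    exact Nat.eq_sub_of_add_eq c3
  · change _ = q - s
    exact Nat.eq_sub_of_add_eq c4
  · change (Finset.univ.filter fun x => G.pairColor u v x = 5).card =
      Fintype.card V + s - p - q - 2
    omega

/-- A graph covered by two nonadjacent vertices is determined up to isomorphism by their degrees,
the number of their common neighbours and the number of vertices. -/
theorem IsPairCover.nonempty_iso {u v : V} {u' v' : W} (h : G.IsPairCover u v)
    (h' : H.IsPairCover u' v') (hadj : ¬ G.Adj u v) (hadj' : ¬ H.Adj u' v')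
    (hu : G.degree u = H.degree u') (hv : G.degree v = H.degree v')
    (hs : (Finset.univ.filter fun w => G.Adj u w ∧ G.Adj v w).card =
      (Finset.univ.filter fun w => H.Adj u' w ∧ H.Adj v' w).card)
    (hn : Fintype.card V = Fintype.card W) : Nonempty (G ≃g H) := by
  obtain ⟨e, he⟩ := exists_equiv_comp_eq (G.pairColor u v) (H.pairColor u' v') fun c => by
    rw [card_filter_pairColor h.1 hadj rfl rfl rfl, card_filter_pairColor h'.1 hadj' rfl rfl rfl,
      hu, hv, hs, hn]
  exact ⟨e, fun {x y} => by
    rw [h'.adj_iff_pairColor hadj', h.adj_iff_pairColor hadj]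
    simp only [he]⟩

end Iso
end SimpleGraph

namespace SimpleGraph

/-! ### Invariants of the other graphs without three disjoint edges -/

section Invariants

variable {V : Type*} {G : SimpleGraph V} [Fintype V] [DecidableEq V] [DecidableRel G.Adj]

/-- The first invariants of a graph whose edges are those of a triangle `x y z` and edges at `v`,
where `v` has `p` neighbours outside the triangle and `j` neighbours in it. -/
theorem IsVertexTriangle.invariants {v x y z : V} (h : G.IsVertexTriangle v x y z) :
    ∃ p j, G.matchingNumber 1 = p + j + 3 ∧ G.matchingNumber 2 = 3 * p + j ∧
      p + 4 ≤ Fintype.card V := by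
  obtain ⟨hx, hy, hz, hxy, hxz, hyz, hall⟩ := h
  have nxy := hxy.ne
  have nxz := hxz.ne
  have nyz := hyz.ne
  set R := (((Finset.univ.erase v).erase x).erase y).erase z with hR
  have mx : x ∈ Finset.univ.erase v := by simp [hx.symm]
  have my : y ∈ (Finset.univ.erase v).erase x := by simp [hy.symm, nxy.symm]
  have mz : z ∈ ((Finset.univ.erase v).erase x).erase y := by
    simp [hz.symm, nxz.symm, nyz.symm]
  have hmem (w : V) : w ∈ R ↔ w ≠ v ∧ w ≠ x ∧ w ≠ y ∧ w ≠ z := by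
    simp only [hR, Finset.mem_erase, Finset.mem_univ, and_true]
    tauto
  have split (f : V → ℕ) : ∑ w, f w = f v + (f x + (f y + (f z + ∑ w ∈ R, f w))) := by
    rw [hR, Finset.add_sum_erase _ _ mz, Finset.add_sum_erase _ _ my,
      Finset.add_sum_erase _ _ mx, Finset.add_sum_erase _ _ (Finset.mem_univ v)]
  have hcard : R.card + 4 = Fintype.card V := by
    have := split fun _ => 1
    simp only [Finset.sum_const, smul_eq_mul, mul_one, Finset.card_univ] at this
    omega
  have hdv : G.degree v = (if G.Adj v x then 1 else 0) + ((if G.Adj v y then 1 else 0) +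
      ((if G.Adj v z then 1 else 0) + ∑ w ∈ R, if G.Adj v w then 1 else 0)) := by
    rw [← card_neighborFinset_eq_degree, neighborFinset_eq_filter, Finset.card_filter, split,
      if_neg G.irrefl, zero_add]
  have hdeg {a b c : V} (hab : G.Adj a b) (hac : G.Adj a c) (hbc : b ≠ c) (hva : v ≠ a)
      (hvb : v ≠ b) (hvc : v ≠ c) (hN : ∀ w, G.Adj a w → w = v ∨ w = b ∨ w = c) :
      G.degree a = 2 + if G.Adj v a then 1 else 0 := by
    have h1 : G.neighborFinset a = {b, c} ∪ if G.Adj v a then {v} else ∅ := by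
      ext w
      have := G.adj_comm v a
      rw [mem_neighborFinset]
      grind
    rw [← card_neighborFinset_eq_degree, h1, Finset.card_union_of_disjoint, Finset.card_pair hbc]
    · split_ifs <;> simp
    · split_ifs <;> simp [hvb, hvc]
  have hN {a : V} (ha : a = x ∨ a = y ∨ a = z) (w : V) (hw : G.Adj a w) :
      w = v ∨ ((w = x ∨ w = y ∨ w = z) ∧ w ≠ a) := by
    have := hall a w hw
    have := hw.ne
    grind
  have hdx := hdeg hxy hxz nyz hx hy hz fun w hw => by have := hN (Or.inl rfl) w hw; tauto
  have hdy := hdeg hxy.symm hyz nxz hy hx hz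
    fun w hw => by have := hN (Or.inr (Or.inl rfl)) w hw; tauto
  have hdz := hdeg hxz.symm hyz.symm nxy hz hx hy
    fun w hw => by have := hN (Or.inr (Or.inr rfl)) w hw; tauto
  have hdR : ∀ w ∈ R, G.degree w = if G.Adj v w then 1 else 0 := by
    intro w hw
    rw [hmem] at hw
    have h1 : G.neighborFinset w = if G.Adj v w then {v} else ∅ := by
      ext a
      have := G.adj_comm v w
      have := hall w a
      rw [mem_neighborFinset]
      grind
    rw [← card_neighborFinset_eq_degree, h1]
    split_ifs <;> simp
  have hdR2 : ∀ w ∈ R, G.degree w ^ 2 = if G.Adj v w then 1 else 0 := by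
    intro w hw
    rw [hdR w hw]
    split_ifs <;> rfl
  have s1 := split fun w => G.degree w
  have s2 := split fun w => G.degree w ^ 2
  rw [Finset.sum_congr rfl hdR] at s1
  rw [Finset.sum_congr rfl hdR2] at s2
  have hp : ∑ w ∈ R, (if G.Adj v w then 1 else 0) ≤ R.card := by
    rw [← Finset.card_filter]
    exact Finset.card_filter_le _ _
  set p := ∑ w ∈ R, if G.Adj v w then 1 else 0
  have ix : (if G.Adj v x then 1 else 0) ^ 2 = if G.Adj v x then 1 else 0 := by split_ifs <;> rfl
  have iy : (if G.Adj v y then 1 else 0) ^ 2 = if G.Adj v y then 1 else 0 := by split_ifs <;> rfl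
  have iz : (if G.Adj v z then 1 else 0) ^ 2 = if G.Adj v z then 1 else 0 := by split_ifs <;> rfl
  simp only [hdv, hdx, hdy, hdz] at s1 s2
  set jx := if G.Adj v x then 1 else 0
  set jy := if G.Adj v y then 1 else 0
  set jz := if G.Adj v z then 1 else 0
  have hm : G.edgeFinset.card = p + (jx + jy + jz) + 3 := by
    have := G.sum_degrees_eq_twice_card_edges
    omega
  refine ⟨p, jx + jy + jz, by rw [matchingNumber_one, hm], ?_, by omega⟩
  have := G.two_mul_matchingNumber_two_add
  rw [s2, hm] at this
  nlinarith

theorem IsTwoTriangles.invariants {a b w c d w' : V} (h : G.IsTwoTriangles a b w c d w') :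
    G.matchingNumber 1 = 6 ∧ G.matchingNumber 2 = 9 ∧ 6 ≤ Fintype.card V := by
  obtain ⟨hnd, hadj⟩ := h
  set S := [a, b, w, c, d, w'].toFinset with hS
  have hc : S.card = 6 := by rw [hS, List.toFinset_card_of_nodup hnd]; rfl
  have hmem (x : V) : x ∈ S ↔ x = a ∨ x = b ∨ x = w ∨ x = c ∨ x = d ∨ x = w' := by simp [hS]
  simp only [List.nodup_cons, List.mem_cons, List.not_mem_nil, or_false, not_or, List.nodup_nil,
    not_false_eq_true, and_true] at hnd
  have two {x y z : V} (hyz : y ≠ z) (hx : ∀ u, G.Adj x u ↔ u = y ∨ u = z) : G.degree x = 2 := by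
    rw [← card_neighborFinset_eq_degree, Finset.card_eq_two]
    refine ⟨y, z, hyz, ?_⟩
    ext u
    simp [hx]
  have hdeg (x : V) : G.degree x = if x ∈ S then 2 else 0 := by
    split_ifs with hx
    · rw [hmem] at hx
      rcases hx with rfl | rfl | rfl | rfl | rfl | rfl
      · exact two (y := b) (z := w) (by grind) fun u => by rw [hadj]; grind
      · exact two (y := a) (z := w) (by grind) fun u => by rw [hadj]; grind
      · exact two (y := a) (z := b) (by grind) fun u => by rw [hadj]; grind
      · exact two (y := d) (z := w') (by grind) fun u => by rw [hadj]; grind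
      · exact two (y := c) (z := w') (by grind) fun u => by rw [hadj]; grind
      · exact two (y := c) (z := d) (by grind) fun u => by rw [hadj]; grind
    · rw [hmem] at hx
      rw [← card_neighborFinset_eq_degree, Finset.card_eq_zero]
      ext u
      simp only [mem_neighborFinset, hadj, Finset.notMem_empty, iff_false]
      grind
  have hm : G.edgeFinset.card = 6 := by
    have := G.sum_degrees_eq_twice_card_edges
    simp only [hdeg, Finset.sum_ite_mem, Finset.univ_inter, Finset.sum_const, hc,
      smul_eq_mul] at this
    omega
  refine ⟨by rw [matchingNumber_one, hm], ?_, hc ▸ Finset.card_le_univ S⟩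
  have := G.two_mul_matchingNumber_two_add
  simp only [hdeg, ite_pow, hm, Finset.sum_ite_mem, Finset.univ_inter, Finset.sum_const, hc,
    smul_eq_mul, ne_eq, OfNat.ofNat_ne_zero, not_false_eq_true, zero_pow] at this
  omega

/-- The Cauchy-Schwarz inequality for the degrees bounds the number of `2`-matchings of a graph
whose edges lie in a set of `c` vertices. -/
theorem four_mul_sq_le_of_support_subset {S : Finset V} {c : ℕ} (hS : S.card = c)
    (h : ∀ x y, G.Adj x y → x ∈ S) :
    4 * G.matchingNumber 1 ^ 2 + 2 * c * G.matchingNumber 2 ≤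
      c * (G.matchingNumber 1 ^ 2 + G.matchingNumber 1) := by
  have h0 (x : V) (hx : x ∉ S) : G.degree x = 0 := by
    rw [← card_neighborFinset_eq_degree, Finset.card_eq_zero]
    ext y
    simp only [mem_neighborFinset, Finset.notMem_empty, iff_false]
    exact fun hxy => hx (h x y hxy)
  have h1 : ∑ x ∈ S, G.degree x = ∑ x, G.degree x :=
    Finset.sum_subset (Finset.subset_univ S) fun x _ hx => h0 x hx
  have h2 : ∑ x ∈ S, G.degree x ^ 2 = ∑ x, G.degree x ^ 2 :=
    Finset.sum_subset (Finset.subset_univ S) fun x _ hx => by rw [h0 x hx]; rfl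
  have h3 := sq_sum_le_card_mul_sum_sq (s := S) (f := fun x => G.degree x)
  rw [h1, h2, G.sum_degrees_eq_twice_card_edges, hS] at h3
  have h4 := G.two_mul_matchingNumber_two_add
  rw [matchingNumber_one, ← h4]
  nlinarith

end Invariants

end SimpleGraph

/-! ### Deciding adjacency in the concrete graphs -/

section Families

instance SimpleGraph.addVertex.instDecidableRelAdj {V : Type*} (G : SimpleGraph V) (S : Set V)
    [DecidableRel G.Adj] [DecidablePred (· ∈ S)] : DecidableRel (G.addVertex S).Adj
  | some a, some b => inferInstanceAs (Decidable (G.Adj a b))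
  | none, some b => inferInstanceAs (Decidable (b ∈ S))
  | some a, none => inferInstanceAs (Decidable (a ∈ S))
  | none, none => inferInstanceAs (Decidable False)

instance completeBipartiteGraph.instDecidableRelAdj (V W : Type*) :
    DecidableRel (completeBipartiteGraph V W).Adj := fun v w =>
  inferInstanceAs (Decidable (v.isLeft ∧ w.isRight ∨ v.isRight ∧ w.isLeft))

instance SimpleGraph.Sum.instDecidableRelAdj {V W : Type*} (G : SimpleGraph V) (H : SimpleGraph W)
    [DecidableRel G.Adj] [DecidableRel H.Adj] : DecidableRel (G ⊕g H).Adj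
  | .inl a, .inl b => inferInstanceAs (Decidable (G.Adj a b))
  | .inr a, .inr b => inferInstanceAs (Decidable (H.Adj a b))
  | .inl _, .inr _ => isFalse (by simp)
  | .inr _, .inl _ => isFalse (by simp)

instance graphK.instDecidableRelAdj (k t ℓ : ℕ) : DecidableRel (graphK k t ℓ).Adj := by
  have : DecidablePred (· ∈ ({v | ∃ i : Fin k, (i : ℕ) < ℓ ∧ v = Sum.inl (Sum.inr i)} ∪
      Set.range Sum.inr : Set ((Fin 1 ⊕ Fin k) ⊕ Fin t))) := fun v =>
    decidable_of_iff ((∃ i : Fin k, (i : ℕ) < ℓ ∧ v = Sum.inl (Sum.inr i)) ∨ ∃ j, Sum.inr j = v)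
      Iff.rfl
  exact SimpleGraph.addVertex.instDecidableRelAdj _ _

instance graphL.instDecidableRelAdj (t ℓ : ℕ) : DecidableRel (graphL t ℓ).Adj := by
  have : DecidablePred (· ∈ ({v | ∃ i : Fin 3, (i : ℕ) < ℓ ∧ v = Sum.inl i} ∪
      Set.range Sum.inr : Set (Fin 3 ⊕ Fin t))) := fun v =>
    decidable_of_iff ((∃ i : Fin 3, (i : ℕ) < ℓ ∧ v = Sum.inl i) ∨ ∃ j, Sum.inr j = v) Iff.rfl
  exact SimpleGraph.addVertex.instDecidableRelAdj _ _

/-- The chord is spelled out because the `DecidableRel` instance of `SimpleGraph.edge` is built by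
rewriting and does not reduce. -/
instance houseGraph.instDecidableRelAdj : DecidableRel houseGraph.Adj :=
  fun v w => decidable_of_iff
    ((SimpleGraph.cycleGraph 5).Adj v w ∨ (v = 0 ∧ w = 2 ∨ v = 2 ∧ w = 0) ∧ v ≠ w)
    (by rw [houseGraph, SimpleGraph.sup_adj, SimpleGraph.edge_adj])

end Families

/-! ### The graphs `K(k, t; ℓ)` -/

section Numbers

/-- The centre of the star and the added vertex cover all edges. -/
theorem graphK_isPairCover (k t ℓ : ℕ) :
    (graphK k t ℓ).IsPairCover (some (.inl (.inl 0))) none := by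
  refine ⟨by simp, ?_⟩
  rintro (_ | ((i | i) | i)) (_ | ((j | j) | j)) <;> simp [graphK, SimpleGraph.addVertex] <;> omega

theorem graphK_center_not_adj (k t ℓ : ℕ) : ¬ (graphK k t ℓ).Adj (some (.inl (.inl 0))) none := by
  simp [graphK, SimpleGraph.addVertex]

theorem graphK_degree_center (k t ℓ : ℕ) : (graphK k t ℓ).degree (some (.inl (.inl 0))) = k := by
  rw [← SimpleGraph.card_neighborFinset_eq_degree, SimpleGraph.neighborFinset_eq_filter,
    Finset.card_filter, Fintype.sum_option, Fintype.sum_sum_type, Fintype.sum_sum_type]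
  simp [graphK, SimpleGraph.addVertex]

theorem graphK_degree_none {k ℓ : ℕ} (t : ℕ) (h : ℓ ≤ k) : (graphK k t ℓ).degree none = ℓ + t := by
  rw [← SimpleGraph.card_neighborFinset_eq_degree, SimpleGraph.neighborFinset_eq_filter,
    Finset.card_filter, Fintype.sum_option, Fintype.sum_sum_type, Fintype.sum_sum_type]
  simp [graphK, SimpleGraph.addVertex, Fin.card_filter_val_lt, h]

theorem graphK_card_common {k ℓ : ℕ} (t : ℕ) (h : ℓ ≤ k) :
    (Finset.univ.filter fun w => (graphK k t ℓ).Adj (some (.inl (.inl 0))) w ∧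
      (graphK k t ℓ).Adj none w).card = ℓ := by
  rw [Finset.card_filter, Fintype.sum_option, Fintype.sum_sum_type, Fintype.sum_sum_type]
  simp [graphK, SimpleGraph.addVertex, Fin.card_filter_val_lt, h]

theorem graphK_card (k t : ℕ) : Fintype.card (Option ((Fin 1 ⊕ Fin k) ⊕ Fin t)) = k + t + 2 := by
  simp
  omega

theorem graphK_matchingNumber {k ℓ : ℕ} (t : ℕ) (h : ℓ ≤ k) :
    (graphK k t ℓ).matchingNumber 1 = k + (ℓ + t) ∧
      (graphK k t ℓ).matchingNumber 2 + ℓ = k * (ℓ + t) := by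
  have hu := (graphK k t ℓ).card_filter_adj_and_ne (some (.inl (.inl 0))) none
  have hv := (graphK k t ℓ).card_filter_adj_and_ne none (some (.inl (.inl 0)))
  rw [if_neg (graphK_center_not_adj k t ℓ), add_zero, graphK_degree_center] at hu
  rw [if_neg fun h => graphK_center_not_adj k t ℓ h.symm, add_zero, graphK_degree_none t h] at hv
  have := (graphK_isPairCover k t ℓ).invariants hu hv (graphK_card_common t h)
    (if_neg (graphK_center_not_adj k t ℓ))
  exact ⟨this.1, this.2.1⟩

end Numbers

/-! ### The comatching pairs -/

section Comatching

namespace SimpleGraph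

theorem noThreeMatching_of_support_subset {V : Type*} {G : SimpleGraph V} {S : Finset V}
    (hS : S.card ≤ 5) (h : ∀ x y, G.Adj x y → x ∈ S) : G.NoThreeMatching := by
  classical
  intro a b c d e f h1 h2 h3 n1 n2 n3 n4 n5 n6 n7 n8 n9 n10 n11 n12
  have hsub : [a, b, c, d, e, f].toFinset ⊆ S := by
    intro x hx
    simp only [List.mem_toFinset, List.mem_cons, List.not_mem_nil, or_false] at hx
    rcases hx with rfl | rfl | rfl | rfl | rfl | rfl
    · exact h _ _ h1
    · exact h _ _ h1.symm
    · exact h _ _ h2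
    · exact h _ _ h2.symm
    · exact h _ _ h3
    · exact h _ _ h3.symm
  have hc := Finset.card_le_card hsub
  have := h1.ne
  have := h2.ne
  have := h3.ne
  rw [List.toFinset_card_of_nodup (by simp; tauto)] at hc
  simp at hc
  omega

end SimpleGraph

/-- A graph without a cover by two vertices is comatching with `K(k, t; ℓ)` as soon as it has the
right number of vertices, degree sum and sum of squared degrees, and no three disjoint edges.
Degrees are written as sums of indicators so that the hypotheses can be evaluated. -/
theorem graphK_comatching {k t ℓ : ℕ} (h : ℓ ≤ k) {W : Type*} [Fintype W] [DecidableEq W]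
    (H : SimpleGraph W) [DecidableRel H.Adj] (hn : Fintype.card W = k + t + 2)
    (h1 : ∑ v, ∑ w, (if H.Adj v w then 1 else 0) = 2 * (k + (ℓ + t)))
    (h2 : ∑ v, (∑ w, if H.Adj v w then 1 else 0) ^ 2 + 2 * (k * (ℓ + t)) =
      (k + (ℓ + t)) ^ 2 + (k + (ℓ + t)) + 2 * ℓ)
    (h3 : H.NoThreeMatching)
    (hc : ∀ u v, ∃ x y, H.Adj x y ∧ x ≠ u ∧ x ≠ v ∧ y ≠ u ∧ y ≠ v) :
    (graphK k t ℓ).Comatching H := by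
  have hK := graphK_matchingNumber t h
  have hdeg (v : W) : (∑ w, if H.Adj v w then 1 else 0) = H.degree v := by
    rw [← SimpleGraph.card_neighborFinset_eq_degree, SimpleGraph.neighborFinset_eq_filter,
      Finset.card_filter]
  simp only [hdeg] at h1 h2
  rw [H.sum_degrees_eq_twice_card_edges] at h1
  have hm : H.edgeFinset.card = k + (ℓ + t) := by omega
  have hH := H.two_mul_matchingNumber_two_add
  rw [hm] at hH
  constructor
  · constructor
    intro e
    obtain ⟨x, y, hxy, hne⟩ := hc (e (some (.inl (.inl 0)))) (e none)
    have := (graphK_isPairCover k t ℓ).2 (e.symm x) (e.symm y) (e.symm.map_adj_iff.2 hxy)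
    simp only [← e.apply_eq_iff_eq, e.apply_symm_apply] at this
    tauto
  · apply SimpleGraph.matchingPoly_eq_of_noThreeMatching
    · rw [Nat.card_eq_fintype_card, Nat.card_eq_fintype_card, graphK_card, hn]
    · rw [hK.1, H.matchingNumber_one, hm]
    · omega
    · exact (graphK_isPairCover k t ℓ).noThreeMatching
    · exact h3

theorem graphL_one_one_isVertexTriangle : (graphL 1 1).IsVertexTriangle none
    (some (.inl 0)) (some (.inl 1)) (some (.inl 2)) := by
  unfold SimpleGraph.IsVertexTriangle
  decide

theorem graphL_two_one_isVertexTriangle : (graphL 2 1).IsVertexTriangle none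
    (some (.inl 0)) (some (.inl 1)) (some (.inl 2)) := by
  unfold SimpleGraph.IsVertexTriangle
  decide

theorem graphL_three_one_isVertexTriangle : (graphL 3 1).IsVertexTriangle none
    (some (.inl 0)) (some (.inl 1)) (some (.inl 2)) := by
  unfold SimpleGraph.IsVertexTriangle
  decide

set_option synthInstance.maxSize 512 in
theorem starK_one_sum_triangle_isVertexTriangle :
    (starK 1 ⊕g (⊤ : SimpleGraph (Fin 3))).IsVertexTriangle
      (.inl (.inl 0)) (.inr 0) (.inr 1) (.inr 2) := by
  unfold SimpleGraph.IsVertexTriangle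
  decide

set_option synthInstance.maxSize 512 in
theorem starK_five_sum_triangle_isVertexTriangle :
    (starK 5 ⊕g (⊤ : SimpleGraph (Fin 3))).IsVertexTriangle
      (.inl (.inl 0)) (.inr 0) (.inr 1) (.inr 2) := by
  unfold SimpleGraph.IsVertexTriangle
  decide

theorem cycleGraph_five_sum_noThreeMatching :
    (SimpleGraph.cycleGraph 5 ⊕g isolatedK 1).NoThreeMatching :=
  SimpleGraph.noThreeMatching_of_support_subset (S := Finset.univ.erase (.inr 0))
    (by decide) (by decide)

theorem houseGraph_noThreeMatching : houseGraph.NoThreeMatching :=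
  SimpleGraph.noThreeMatching_of_support_subset (S := Finset.univ) (by decide) (by simp)

set_option synthInstance.maxSize 512 in
theorem graphK_2_1_1_comatching :
    (graphK 2 1 1).Comatching (starK 1 ⊕g (⊤ : SimpleGraph (Fin 3))) :=
  graphK_comatching (by decide) _ (by decide) (by decide) (by decide)
    starK_one_sum_triangle_isVertexTriangle.noThreeMatching (by decide)

theorem graphK_2_1_2_comatching :
    (graphK 2 1 2).Comatching (graphL 1 1) :=
  graphK_comatching (by decide) _ (by decide) (by decide) (by decide)
    graphL_one_one_isVertexTriangle.noThreeMatching (by decide)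

theorem graphK_2_2_1_comatching :
    (graphK 2 2 1).Comatching (SimpleGraph.cycleGraph 5 ⊕g isolatedK 1) :=
  graphK_comatching (by decide) _ (by decide) (by decide) (by decide)
    cycleGraph_five_sum_noThreeMatching (by decide)

theorem graphK_3_0_2_comatching :
    (graphK 3 0 2).Comatching (graphL 1 1) :=
  graphK_comatching (by decide) _ (by decide) (by decide) (by decide)
    graphL_one_one_isVertexTriangle.noThreeMatching (by decide)

theorem graphK_3_1_1_comatching :
    (graphK 3 1 1).Comatching (SimpleGraph.cycleGraph 5 ⊕g isolatedK 1) :=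
  graphK_comatching (by decide) _ (by decide) (by decide) (by decide)
    cycleGraph_five_sum_noThreeMatching (by decide)

theorem graphK_3_1_2_comatching :
    (graphK 3 1 2).Comatching (graphL 2 1) :=
  graphK_comatching (by decide) _ (by decide) (by decide) (by decide)
    graphL_two_one_isVertexTriangle.noThreeMatching (by decide)

theorem graphK_3_2_2_comatching :
    (graphK 3 2 2).Comatching (graphL 3 1) :=
  graphK_comatching (by decide) _ (by decide) (by decide) (by decide)
    graphL_three_one_isVertexTriangle.noThreeMatching (by decide)

theorem graphK_3_0_3_comatching :
    (graphK 3 0 3).Comatching houseGraph :=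
  graphK_comatching (by decide) _ (by decide) (by decide) (by decide)
    houseGraph_noThreeMatching (by decide)

theorem graphK_4_1_2_comatching :
    (graphK 4 1 2).Comatching (graphL 3 1) :=
  graphK_comatching (by decide) _ (by decide) (by decide) (by decide)
    graphL_three_one_isVertexTriangle.noThreeMatching (by decide)

set_option synthInstance.maxSize 512 in
theorem graphK_4_3_1_comatching :
    (graphK 4 3 1).Comatching (starK 5 ⊕g (⊤ : SimpleGraph (Fin 3))) :=
  graphK_comatching (by decide) _ (by decide) (by decide) (by decide)
    starK_five_sum_triangle_isVertexTriangle.noThreeMatching (by decide)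

end Comatching

/-! ### Arithmetic of the invariants -/

section Arithmetic

/-- A pair of natural numbers that differ by at most one maximizes the product for a given sum. -/
theorem eq_or_eq_swap_of_mul_le {p q a b : ℕ} (hs : p + q = a + b) (hm : a * b ≤ p * q)
    (h1 : a ≤ b + 1) (h2 : b ≤ a + 1) : (p = a ∧ q = b) ∨ (p = b ∧ q = a) := by
  by_cases ha : p = a
  · omega
  by_cases hb : p = b
  · omega
  exfalso
  -- `p` lies on one side of both `a` and `b`, but `(p - a) * (p - b) = a * b - p * q ≤ 0`
  zify at hs hm
  have hq : (q : ℤ) = a + b - p := by linarith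
  rw [hq] at hm
  rcases (by omega : (p < a ∧ p < b) ∨ (a < p ∧ b < p)) with ⟨h3, h4⟩ | ⟨h3, h4⟩ <;> zify at h3 h4
  · nlinarith [mul_pos (sub_pos.2 h3) (sub_pos.2 h4)]
  · nlinarith [mul_pos (sub_pos.2 h3) (sub_pos.2 h4)]

/-- The triples `(k, t, ℓ)` for which `K(k, t; ℓ)` is not matching unique. -/
def IsExceptional (k t ℓ : ℕ) : Prop :=
  (k, t, ℓ) ∈ ({(2, 1, 1), (2, 1, 2), (2, 2, 1), (3, 0, 2), (3, 1, 1), (3, 1, 2), (3, 2, 2),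
    (3, 0, 3), (4, 1, 2), (4, 3, 1)} : Set (ℕ × ℕ × ℕ))

variable {k t ℓ : ℕ}

theorem isExceptional_iff : IsExceptional k t ℓ ↔
    (k = 2 ∧ t = 1 ∧ ℓ = 1) ∨ (k = 2 ∧ t = 1 ∧ ℓ = 2) ∨ (k = 2 ∧ t = 2 ∧ ℓ = 1) ∨
    (k = 3 ∧ t = 0 ∧ ℓ = 2) ∨ (k = 3 ∧ t = 1 ∧ ℓ = 1) ∨ (k = 3 ∧ t = 1 ∧ ℓ = 2) ∨
    (k = 3 ∧ t = 2 ∧ ℓ = 2) ∨ (k = 3 ∧ t = 0 ∧ ℓ = 3) ∨ (k = 4 ∧ t = 1 ∧ ℓ = 2) ∨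
    (k = 4 ∧ t = 3 ∧ ℓ = 1) := by
  simp [IsExceptional]

/-- The numerical conditions on a cover by two adjacent vertices hold only for the paths with three
and four vertices. -/
theorem eq_zero_and_eq_one_of_adjacent_cover (hℓ1 : 1 ≤ ℓ) (hℓ : ℓ ≤ k)
    (hb1 : k ≤ ℓ + t + 1) (hb2 : ℓ + t ≤ k + 1) {p q s N : ℕ} (h1 : p + q + 1 = k + (ℓ + t))
    (h2 : N + s = p * q) (h3 : N + ℓ = k * (ℓ + t)) (h4 : p + q + 2 ≤ k + t + 2 + s) :
    s = 0 ∧ (p = 1 ∨ q = 1) := by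
  have hm : k + (ℓ + t) ≤ 3 := by
    have h5 : 4 * (p * q) ≤ (p + q) ^ 2 := by
      rw [← mul_assoc]
      exact four_mul_le_sq_add p q
    have h6 : (k + (ℓ + t)) ^ 2 ≤ 4 * (k * (ℓ + t)) + 1 := by
      rcases (by omega : ℓ + t = k ∨ ℓ + t = k + 1 ∨ k = ℓ + t + 1) with h | h | h <;>
        rw [h] <;> nlinarith
    rw [← h1] at h6
    nlinarith
  have hp : p ≤ 2 := by omega
  have hq : q ≤ 2 := by omega
  have hk : k ≤ 3 := by omega
  interval_cases k <;> interval_cases p <;> interval_cases q <;> omega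

/-- A vertex with `p` neighbours outside a triangle and `j` in it can share its invariants with
`K(k, t; ℓ)` only for exceptional triples. -/
theorem isExceptional_of_vertexTriangle (hℓ1 : 1 ≤ ℓ) (hℓ : ℓ ≤ k)
    (hb1 : k ≤ ℓ + t + 1) (hb2 : ℓ + t ≤ k + 1) {p j : ℕ} (h1 : p + j + 3 = k + (ℓ + t))
    (h2 : 3 * p + j + ℓ = k * (ℓ + t)) (h3 : p + 4 ≤ k + t + 2) : IsExceptional k t ℓ := by
  -- `(k - 3) * (ℓ + t - 3) = ℓ - 2 * j ≤ 1 - j`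
  have hk : k ≤ 4 := by
    by_contra! hk
    obtain ⟨x, rfl⟩ := Nat.exists_eq_add_of_le (show 5 ≤ k by omega)
    obtain ⟨y, hy⟩ := Nat.exists_eq_add_of_le (show 4 ≤ ℓ + t by omega)
    rw [hy, show (5 + x) * (4 + y) = 20 + 4 * x + 5 * y + x * y by ring] at h2
    generalize x * y = z at h2
    omega
  have ht : ℓ + t ≤ 4 := by
    by_contra! ht
    obtain ⟨x, rfl⟩ := Nat.exists_eq_add_of_le (show 4 ≤ k by omega)
    obtain ⟨y, hy⟩ := Nat.exists_eq_add_of_le (show 5 ≤ ℓ + t by omega)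
    rw [hy, show (4 + x) * (5 + y) = 20 + 5 * x + 4 * y + x * y by ring] at h2
    generalize x * y = z at h2
    omega
  rw [isExceptional_iff]
  have ht' : t ≤ 4 := by omega
  interval_cases k <;> interval_cases t <;> omega

/-- Two disjoint triangles would force `k = ℓ + t = 3` and `ℓ = 0`. -/
theorem not_twoTriangles (hℓ1 : 1 ≤ ℓ) (hb1 : k ≤ ℓ + t + 1) (hb2 : ℓ + t ≤ k + 1)
    (h1 : 6 = k + (ℓ + t)) (h2 : 9 + ℓ = k * (ℓ + t)) : False := by
  obtain rfl : k = 3 := by omega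
  omega

/-- The Cauchy-Schwarz inequality for degrees supported on five vertices bounds the number
`m` of edges; the remaining triples are exceptional. -/
theorem isExceptional_of_five_vertices (hℓ1 : 1 ≤ ℓ) (hℓ : ℓ ≤ k)
    (hb1 : k ≤ ℓ + t + 1) (hb2 : ℓ + t ≤ k + 1) {m N : ℕ} (h1 : m = k + (ℓ + t))
    (h2 : N + ℓ = k * (ℓ + t)) (h3 : 4 * m ^ 2 + 2 * 5 * N ≤ 5 * (m ^ 2 + m))
    (h4 : 5 ≤ k + t + 2) : IsExceptional k t ℓ := by
  subst h1
  rw [isExceptional_iff]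
  have hk : k ≤ 4 := by
    rcases (by omega : ℓ + t = k ∨ ℓ + t = k + 1 ∨ k = ℓ + t + 1) with h | h | h
    · rw [h] at h2 h3
      nlinarith
    · rw [h] at h2 h3
      nlinarith
    · rw [h] at h2 h3
      nlinarith
  have ht : t ≤ 5 := by omega
  interval_cases k <;> interval_cases t <;> interval_cases ℓ <;> omega

end Arithmetic

/-! ### Matching uniqueness -/

section Uniqueness

namespace SimpleGraph

variable {V : Type*} [Fintype V] [DecidableEq V] {G : SimpleGraph V} [DecidableRel G.Adj] {u v : V}

/-- If `u` and `v` are adjacent, `u` has only one neighbour `x` besides `v`, and no vertex is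
adjacent to both, then the edges at `u` are covered by the nonadjacent pair `x`, `v`. -/
theorem IsPairCover.exists_nonadjacent (h : G.IsPairCover u v)
    (hp : (Finset.univ.filter fun w => G.Adj u w ∧ w ≠ v).card = 1)
    (hs : (Finset.univ.filter fun w => G.Adj u w ∧ G.Adj v w).card = 0) :
    ∃ x, G.IsPairCover x v ∧ ¬ G.Adj x v := by
  obtain ⟨x, hx⟩ := Finset.card_eq_one.1 hp
  have hx' (w : V) : (G.Adj u w ∧ w ≠ v) ↔ w = x := by
    have := congrArg (w ∈ ·) hx
    simpa using this
  have hs' (w : V) (hw : G.Adj u w) : ¬ G.Adj v w := by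
    have := Finset.filter_eq_empty_iff.1 (Finset.card_eq_zero.1 hs) (Finset.mem_univ w)
    tauto
  have hux := (hx' x).2 rfl
  refine ⟨x, ⟨hux.2, fun a b hab => ?_⟩, fun hxv => hs' x hux.1 hxv.symm⟩
  rcases h.2 a b hab with rfl | rfl | rfl | rfl
  · have := hx' b
    tauto
  · tauto
  · have := hx' a
    have := hab.symm
    tauto
  · tauto

/-- A graph with the matching numbers of `K(k, t; ℓ)` that is covered by a nonadjacent pair is
isomorphic to it. -/
theorem IsPairCover.nonempty_iso_graphK {k t ℓ : ℕ} (hℓ : ℓ ≤ k)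
    (hb1 : k ≤ ℓ + t + 1) (hb2 : ℓ + t ≤ k + 1) (h : G.IsPairCover u v) (hadj : ¬ G.Adj u v)
    (hn : Fintype.card V = k + t + 2) (h1 : G.matchingNumber 1 = k + (ℓ + t))
    (h2 : G.matchingNumber 2 + ℓ = k * (ℓ + t)) : Nonempty (graphK k t ℓ ≃g G) := by
  have hu := G.card_filter_adj_and_ne u v
  have hv := G.card_filter_adj_and_ne v u
  rw [if_neg hadj, add_zero] at hu
  rw [if_neg fun h => hadj h.symm, add_zero] at hv
  have hinv := h.invariants hu hv rfl (if_neg hadj)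
  generalize hs : (Finset.univ.filter fun w => G.Adj u w ∧ G.Adj v w).card = s at hinv
  generalize hp : G.degree u = p at hinv
  generalize hq : G.degree v = q at hinv
  obtain ⟨i1, i2, i3⟩ := hinv
  have hpq : p + q = k + (ℓ + t) := by omega
  -- the vertex count bounds `s` from below, and `p * q ≤ k * (ℓ + t)` bounds it from above
  have hls : ℓ ≤ s := by omega
  have hcase : (p = k ∧ q = ℓ + t) ∨ (p = ℓ + t ∧ q = k) := by
    exact eq_or_eq_swap_of_mul_le hpq (by omega) hb1 hb2
  have hsl : s = ℓ := by
    rcases hcase with ⟨rfl, rfl⟩ | ⟨rfl, rfl⟩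
    · omega
    · rw [mul_comm] at i2
      omega
  have hc := graphK_isPairCover k t ℓ
  have hna := graphK_center_not_adj k t ℓ
  have hcd := graphK_degree_center k t ℓ
  have hnd := graphK_degree_none t hℓ
  have hcn : Fintype.card (Option ((Fin 1 ⊕ Fin k) ⊕ Fin t)) = Fintype.card V := by
    rw [graphK_card, hn]
  rcases hcase with ⟨hpk, hqk⟩ | ⟨hpk, hqk⟩
  · exact hc.nonempty_iso h hna hadj (by rw [hcd, hp, hpk]) (by rw [hnd, hq, hqk])
      (by rw [graphK_card_common t hℓ, hs, hsl]) hcn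
  · refine hc.nonempty_iso h.symm hna (fun h => hadj h.symm) (by rw [hcd, hq, hqk])
      (by rw [hnd, hp, hpk]) ?_ hcn
    rw [graphK_card_common t hℓ, ← hsl, ← hs]
    simp only [and_comm]

end SimpleGraph
/-- Outside the exceptional triples, the matching polynomial determines `K(k, t; ℓ)`. -/
theorem nonempty_iso_of_matchingPoly_eq {k t ℓ : ℕ} (hℓ1 : 1 ≤ ℓ) (hℓ : ℓ ≤ k)
    (hb1 : k ≤ ℓ + t + 1) (hb2 : ℓ + t ≤ k + 1) (hne : ¬ IsExceptional k t ℓ)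
    {W : Type*} [Finite W] (H : SimpleGraph W)
    (hH : (graphK k t ℓ).matchingPoly = H.matchingPoly) : Nonempty (graphK k t ℓ ≃g H) := by
  classical
  have := Fintype.ofFinite W
  obtain ⟨h1, h2⟩ := graphK_matchingNumber t hℓ
  have hn : Fintype.card W = k + t + 2 := by
    rw [← graphK_card, ← Nat.card_eq_fintype_card, ← Nat.card_eq_fintype_card]
    exact (SimpleGraph.card_eq_of_matchingPoly_eq hH).symm
  have hno : H.NoThreeMatching := by
    rw [← SimpleGraph.matchingNumber_three_eq_zero_iff,
      ← SimpleGraph.matchingNumber_eq_of_matchingPoly_eq hH,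
      SimpleGraph.matchingNumber_three_eq_zero_iff]
    exact (graphK_isPairCover k t ℓ).noThreeMatching
  rw [SimpleGraph.matchingNumber_eq_of_matchingPoly_eq hH] at h1 h2
  obtain ⟨a, b, hab⟩ : ∃ a b, H.Adj a b := by
    rw [SimpleGraph.matchingNumber_one] at h1
    obtain ⟨e, he⟩ := Finset.card_pos.1 (show 0 < H.edgeFinset.card by omega)
    induction e with | _ a b
    exact ⟨a, b, by simpa using he⟩
  rcases hno.classification hab with ⟨u, v, h⟩ | ⟨v, x, y, z, h⟩ |
    ⟨a, b, w, c, d, w', h⟩ | ⟨S, hS, h⟩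
  · by_cases hadj : H.Adj u v
    · have hinv := h.invariants rfl rfl rfl (if_pos hadj)
      rw [h1, hn] at hinv
      obtain ⟨i1, i2, i3⟩ := hinv
      obtain ⟨hs, hp | hq⟩ :=
        eq_zero_and_eq_one_of_adjacent_cover hℓ1 hℓ hb1 hb2 i1.symm i2 h2 i3
      · obtain ⟨x, hx, hna⟩ := h.exists_nonadjacent hp hs
        exact hx.nonempty_iso_graphK hℓ hb1 hb2 hna hn h1 h2
      · simp only [and_comm (a := H.Adj u _)] at hs
        obtain ⟨x, hx, hna⟩ := h.symm.exists_nonadjacent hq hs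
        exact hx.nonempty_iso_graphK hℓ hb1 hb2 hna hn h1 h2
    · exact h.nonempty_iso_graphK hℓ hb1 hb2 hadj hn h1 h2
  · obtain ⟨p, j, i1, i2, i3⟩ := h.invariants
    rw [i1] at h1
    rw [i2] at h2
    rw [hn] at i3
    exact (hne (isExceptional_of_vertexTriangle hℓ1 hℓ hb1 hb2 h1 h2 i3)).elim
  · obtain ⟨i1, i2, -⟩ := h.invariants
    rw [i1] at h1
    rw [i2] at h2
    exact (not_twoTriangles hℓ1 hb1 hb2 h1 h2).elim
  · have hcs := SimpleGraph.four_mul_sq_le_of_support_subset hS h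
    have hn5 := Finset.card_le_univ S
    rw [hS, hn] at hn5
    exact (hne (isExceptional_of_five_vertices hℓ1 hℓ hb1 hb2 h1 h2 hcs hn5)).elim

theorem graphK_matchingUnique_iff {k t ℓ : ℕ} (hℓ1 : 1 ≤ ℓ) (hℓ : ℓ ≤ k)
    (hb1 : k ≤ ℓ + t + 1) (hb2 : ℓ + t ≤ k + 1) :
    (graphK k t ℓ).MatchingUnique ↔ ¬ IsExceptional k t ℓ := by
  constructor
  · intro h hex
    rw [isExceptional_iff] at hex
    rcases hex with ⟨rfl, rfl, rfl⟩ | ⟨rfl, rfl, rfl⟩ | ⟨rfl, rfl, rfl⟩ | ⟨rfl, rfl, rfl⟩ |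
      ⟨rfl, rfl, rfl⟩ | ⟨rfl, rfl, rfl⟩ | ⟨rfl, rfl, rfl⟩ | ⟨rfl, rfl, rfl⟩ | ⟨rfl, rfl, rfl⟩ |
      ⟨rfl, rfl, rfl⟩
    · exact h _ _ graphK_2_1_1_comatching
    · exact h _ _ graphK_2_1_2_comatching
    · exact h _ _ graphK_2_2_1_comatching
    · exact h _ _ graphK_3_0_2_comatching
    · exact h _ _ graphK_3_1_1_comatching
    · exact h _ _ graphK_3_1_2_comatching
    · exact h _ _ graphK_3_2_2_comatching
    · exact h _ _ graphK_3_0_3_comatching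
    · exact h _ _ graphK_4_1_2_comatching
    · exact h _ _ graphK_4_3_1_comatching
  · intro hne W _ H ⟨hiso, hpoly⟩
    obtain ⟨e⟩ := nonempty_iso_of_matchingPoly_eq hℓ1 hℓ hb1 hb2 hne H hpoly
    exact hiso.false e

end Uniqueness
theorem mainTheorem2 :
    (∀ k t ℓ : ℕ, 1 ≤ ℓ → ℓ ≤ k → |(ℓ : ℤ) + (t : ℤ) - (k : ℤ)| ≤ 1 →
      ((graphK k t ℓ).MatchingUnique ↔
        (k, t, ℓ) ∉ ({(2, 1, 1), (2, 1, 2), (2, 2, 1), (3, 0, 2), (3, 1, 1), (3, 1, 2), (3, 2, 2),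
          (3, 0, 3), (4, 1, 2), (4, 3, 1)} : Set (ℕ × ℕ × ℕ)))) ∧
    (graphK 2 1 1).Comatching (starK 1 ⊕g (⊤ : SimpleGraph (Fin 3))) ∧
    (graphK 2 1 2).Comatching (graphL 1 1) ∧
    (graphK 2 2 1).Comatching (SimpleGraph.cycleGraph 5 ⊕g isolatedK 1) ∧
    (graphK 3 0 2).Comatching (graphL 1 1) ∧
    (graphK 3 1 1).Comatching (SimpleGraph.cycleGraph 5 ⊕g isolatedK 1) ∧
    (graphK 3 1 2).Comatching (graphL 2 1) ∧
    (graphK 3 2 2).Comatching (graphL 3 1) ∧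
    (graphK 3 0 3).Comatching houseGraph ∧
    (graphK 4 1 2).Comatching (graphL 3 1) ∧
    (graphK 4 3 1).Comatching (starK 5 ⊕g (⊤ : SimpleGraph (Fin 3))) := by
  refine ⟨fun k t ℓ hℓ1 hℓ hb => ?_, graphK_2_1_1_comatching, graphK_2_1_2_comatching,
    graphK_2_2_1_comatching, graphK_3_0_2_comatching, graphK_3_1_1_comatching,
    graphK_3_1_2_comatching, graphK_3_2_2_comatching, graphK_3_0_3_comatching,
    graphK_4_1_2_comatching, graphK_4_3_1_comatching⟩
  rw [abs_le] at hb
  exact graphK_matchingUnique_iff hℓ1 hℓ (by omega) (by omega)
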